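/- The Shannon game $(G,s,t)$ is played on a finite simple graph $G$ with two distinct vertices $s,t$, called terminals. Two players, Short and Cut, alternately take a non-terminal vertex that has not been taken yet, until no such vertex is left. Short wins if $G$ then has a path from $s$ to $t$ all of whose inner vertices were taken by Short; otherwise Cut wins. The game $(G,s,t)$ is a strong link if Short has a winning strategy as second player, and a weak link if each of the two players has a winning strategy when moving first. A weak link is minimal if the deletion of any single edge of $G$ weakens it, that is, yields a game that is neither a weak nor a strong link. The weight $w$ is the number of non-terminal vertices of $G$, the centre is the set of vertices that are neither terminals nor adjacent to a terminal, $p$ is the size of the centre, and $d_s,d_t$ are the degrees of $s,t$ in $G$. Theorem. For every minimal weak link of weight $w$: \[ w>3 \;\Rightarrow\; p\ge 1, \qquad\qquad w>5 \;\Rightarrow\; p\ge 2, \] and if $w\le 7$, then \[ d_s+d_t\le \frac{w+3}{2}. \] -/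

import Mathlib

namespace ShannonGame

variable {V : Type*}

/-- The two players: Short tries to join the terminals, Cut tries to separate them. -/
inductive Player
  | short
  | cut

/-- A vertex that can still be played when `S` is the set of vertices taken by Short and `C` the
set of vertices taken by Cut: a non-terminal vertex that neither player has taken. -/
def Free (s t : V) (S C : Set V) (v : V) : Prop :=
  v ≠ s ∧ v ≠ t ∧ v ∉ S ∧ v ∉ C

/-- The vertices in `S`, together with the terminals, contain a path from `s` to `t`. -/
def Joined (G : SimpleGraph V) (s t : V) (S : Set V) : Prop :=
  ∃ W : G.Walk s t, ∀ v ∈ W.support, v = s ∨ v = t ∨ v ∈ S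

/-- `ShortWins G s t m S C`: Short has a winning strategy in the Shannon game `(G, s, t)` from the
position in which Short has taken `S`, Cut has taken `C`, and player `m` is to move. The players
alternately take a free vertex until none is left; then Short has won if and only if the terminals
are joined through Short's vertices. -/
inductive ShortWins (G : SimpleGraph V) (s t : V) : Player → Set V → Set V → Prop
  | finished (m : Player) (S C : Set V) (hfull : ∀ v, ¬ Free s t S C v)
      (hwin : Joined G s t S) : ShortWins G s t m S C
  | move (S C : Set V) (v : V) (hv : Free s t S C v)
      (h : ShortWins G s t Player.cut (insert v S) C) : ShortWins G s t Player.short S C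
  | reply (S C : Set V) (hne : ∃ v, Free s t S C v)
      (h : ∀ v, Free s t S C v → ShortWins G s t Player.short S (insert v C)) :
      ShortWins G s t Player.cut S C

/-- `CutWins G s t m S C`: Cut has a winning strategy in the Shannon game `(G, s, t)` from the
position in which Short has taken `S`, Cut has taken `C`, and player `m` is to move. -/
inductive CutWins (G : SimpleGraph V) (s t : V) : Player → Set V → Set V → Prop
  | finished (m : Player) (S C : Set V) (hfull : ∀ v, ¬ Free s t S C v)
      (hwin : ¬ Joined G s t S) : CutWins G s t m S C
  | move (S C : Set V) (v : V) (hv : Free s t S C v)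
      (h : CutWins G s t Player.short S (insert v C)) : CutWins G s t Player.cut S C
  | reply (S C : Set V) (hne : ∃ v, Free s t S C v)
      (h : ∀ v, Free s t S C v → CutWins G s t Player.cut (insert v S) C) :
      CutWins G s t Player.short S C

/-- Strong link: Short has a second-player winning strategy. -/
def IsStrongLink (G : SimpleGraph V) (s t : V) : Prop :=
  ShortWins G s t Player.cut ∅ ∅

/-- Weak link: both players have a first-player winning strategy. -/
def IsWeakLink (G : SimpleGraph V) (s t : V) : Prop :=
  ShortWins G s t Player.short ∅ ∅ ∧ CutWins G s t Player.cut ∅ ∅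

/-- Minimal weak link: a weak link that the deletion of any single edge weakens, so that it is no
longer a link, neither a weak nor a strong one. -/
def IsMinimalWeakLink (G : SimpleGraph V) (s t : V) : Prop :=
  IsWeakLink G s t ∧
    ∀ e ∈ G.edgeSet, ¬ IsWeakLink (G.deleteEdges {e}) s t ∧ ¬ IsStrongLink (G.deleteEdges {e}) s t

/-- The weight: the number of vertices other than the terminals. -/
noncomputable def weight (s t : V) : ℕ :=
  {v : V | v ≠ s ∧ v ≠ t}.ncard

/-- The centre: the vertices that are neither terminals nor neighbours of a terminal. -/
def centre (G : SimpleGraph V) (s t : V) : Set V :=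
  {v | v ≠ s ∧ v ≠ t ∧ ¬ G.Adj s v ∧ ¬ G.Adj t v}

end ShannonGame

/-!
Call `G` critical if Short wins it as first player but wins no proper subgraph. The edges of a
critical graph live on every set of vertices that already contains a winning pattern for Short. A
common neighbour of the terminals is such a pattern, and so is a vertex on two bridges (edges
between the two neighbourhoods) together with its two partners; this bounds the weight by `1 + p`
and `3 + p`. In all other cases the terminals have disjoint neighbourhoods and the bridges form a
matching.

Cut can play second by answering each move of Short with its partner in a matching. With an empty
centre, every path of Short contains a bridge, so pairing along the bridges is a win for Cut; hence
a critical graph with `p = 0` has weight at most `3`. With a single central vertex `c`, a path of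
Short that avoids all bridges passes through `c`, and Cut may moreover pair `c` with one vertex off
the bridges. As all of these pairings must fail, there are enough common neighbours of `c` with `s`
and `t` to give Short a win on five vertices including `c`, whence the weight is at most `5`. The
degree bound then follows from `d_s + d_t + p = w`.
-/

namespace ShannonGame

variable {V : Type*} {G H M : SimpleGraph V} {s t : V} {S C : Set V}

lemma free_comm {v : V} : Free s t S C v ↔ Free t s S C v := by
  simp only [Free]
  tauto

lemma free_empty {v : V} : Free s t ∅ ∅ v ↔ v ≠ s ∧ v ≠ t := by
  simp only [Free, Set.mem_empty_iff_false, not_false_eq_true, and_true]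

lemma free_insert_left {v x : V} : Free s t (insert x S) C v ↔ Free s t S C v ∧ v ≠ x := by
  simp only [Free, Set.mem_insert_iff]
  tauto

lemma free_insert_right {v x : V} : Free s t S (insert x C) v ↔ Free s t S C v ∧ v ≠ x := by
  simp only [Free, Set.mem_insert_iff]
  tauto

lemma Joined.symm (h : Joined G s t S) : Joined G t s S := by
  obtain ⟨W, hW⟩ := h
  refine ⟨W.reverse, fun v hv => ?_⟩
  rw [W.support_reverse, List.mem_reverse] at hv
  exact or_left_comm.mp (hW v hv)

lemma Joined.mono_graph (hle : H ≤ G) (h : Joined H s t S) : Joined G s t S := by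
  obtain ⟨W, hW⟩ := h
  exact ⟨W.mapLe hle, by simpa using hW⟩

lemma Joined.mono {S' : Set V} (hS : S ⊆ S') (h : Joined G s t S) : Joined G s t S' := by
  obtain ⟨W, hW⟩ := h
  exact ⟨W, fun v hv => (hW v hv).imp_right (Or.imp_right (@hS v))⟩

lemma Joined.induce {X : Set V} (hX : insert s (insert t S) ⊆ X) (h : Joined G s t S) :
    Joined (G.induce X).spanningCoe s t S := by
  obtain ⟨W, hW⟩ := h
  let W' := (W.induce X fun v hv => hX (hW v hv)).map
    (SimpleGraph.Embedding.spanningCoe (G.induce X)).toHom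
  refine ⟨W', fun v hv => hW v ?_⟩
  obtain ⟨u, hu, rfl⟩ := List.mem_map.mp (SimpleGraph.Walk.support_map .. ▸ hv)
  rw [SimpleGraph.Walk.support_induce] at hu
  exact List.mem_attachWith .. |>.mp hu

lemma not_adj_of_not_joined (h : ¬ Joined G s t S) : ¬ G.Adj s t :=
  fun hadj => h ⟨.cons hadj .nil, by simp⟩

lemma ne_of_not_joined (h : ¬ Joined G s t S) : s ≠ t := by
  rintro rfl
  exact h ⟨.nil, by simp⟩

lemma joined_of_common_neighbor {a : V} (hsa : G.Adj s a) (hta : G.Adj t a) (ha : a ∈ S) :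
    Joined G s t S :=
  ⟨.cons hsa (.cons hta.symm .nil), by simp [ha]⟩

lemma joined_of_path_two {a b : V} (hsa : G.Adj s a) (hab : G.Adj a b) (htb : G.Adj t b)
    (ha : a ∈ S) (hb : b ∈ S) : Joined G s t S :=
  ⟨.cons hsa (.cons hab (.cons htb.symm .nil)), by simp [ha, hb]⟩

lemma joined_of_path_three {a b c : V} (ha : a ∈ G.commonNeighbors s c)
    (hb : b ∈ G.commonNeighbors t c) (haS : a ∈ S) (hbS : b ∈ S) (hcS : c ∈ S) :
    Joined G s t S := by
  rw [SimpleGraph.mem_commonNeighbors] at ha hb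
  exact ⟨.cons ha.1 (.cons ha.2.symm (.cons hb.2 (.cons hb.1.symm .nil))), by simp [haS, hbS, hcS]⟩

lemma ShortWins.symm {m : Player} (h : ShortWins G s t m S C) : ShortWins G t s m S C := by
  induction h with
  | finished m S C hfull hwin => exact .finished m S C (by simpa only [free_comm]) hwin.symm
  | move S C v hv _ ih => exact .move S C v (free_comm.mp hv) ih
  | reply S C hne _ ih =>
    exact .reply S C (hne.imp fun _ => free_comm.mp) fun v hv => ih v (free_comm.mp hv)

lemma ShortWins.mono_graph {m : Player} (hle : H ≤ G) (h : ShortWins H s t m S C) :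
    ShortWins G s t m S C := by
  induction h with
  | finished m S C hfull hwin => exact .finished m S C hfull (hwin.mono_graph hle)
  | move S C v hv _ ih => exact .move S C v hv ih
  | reply S C hne _ ih => exact .reply S C hne ih

lemma CutWins.anti_graph {m : Player} (hle : H ≤ G) (h : CutWins G s t m S C) :
    CutWins H s t m S C := by
  induction h with
  | finished m S C hfull hwin => exact .finished m S C hfull fun hJ => hwin (hJ.mono_graph hle)
  | move S C v hv _ ih => exact .move S C v hv ih
  | reply S C hne _ ih => exact .reply S C hne ih

lemma CutWins.not_joined {m : Player} (h : CutWins G s t m S C) : ¬ Joined G s t S := by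
  induction h with
  | finished _ _ _ _ hwin => exact hwin
  | move _ _ _ _ _ ih => exact ih
  | reply _ _ hne _ ih =>
    obtain ⟨v, hv⟩ := hne
    exact fun hJ => ih v hv (hJ.mono (Set.subset_insert _ _))

section Threats

variable [Finite V]

lemma Joined.shortWins (h : Joined G s t S) (m : Player) : ShortWins G s t m S C := by
  induction hF : {v | Free s t S C v} using WellFoundedLT.induction generalizing m S C with
  | _ F ih =>
    subst hF
    by_cases hfree : ∃ v, Free s t S C v
    · cases m with
      | short =>
        obtain ⟨v, hv⟩ := hfree
        refine .move S C v hv (ih _ ?_ (h.mono (Set.subset_insert v S)) _ rfl)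
        exact ⟨fun x hx => (free_insert_left.mp hx).1,
          fun hsub => (free_insert_left.mp (hsub hv)).2 rfl⟩
      | cut =>
        refine .reply S C hfree fun v hv => ih _ ?_ h _ rfl
        exact ⟨fun x hx => (free_insert_right.mp hx).1,
          fun hsub => (free_insert_right.mp (hsub hv)).2 rfl⟩
    · exact .finished m S C (not_exists.mp hfree) h

lemma shortWins_of_joined_insert {x : V} (hx : Free s t S C x)
    (h : Joined G s t (insert x S)) : ShortWins G s t .short S C :=
  .move S C x hx (h.shortWins .cut)

lemma shortWins_cut_of_threat {x : V} (hx : Free s t S C x) (hJ : Joined G s t (insert x S))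
    (h : ShortWins G s t .short S (insert x C)) : ShortWins G s t .cut S C := by
  refine .reply S C ⟨x, hx⟩ fun v _ => ?_
  obtain rfl | hxv := eq_or_ne x v
  · exact h
  · exact shortWins_of_joined_insert (free_insert_right.mpr ⟨hx, hxv⟩) hJ

lemma shortWins_of_fork {x y z : V} (hfree : ∀ v ∈ [x, y, z], Free s t S C v)
    (hnodup : [x, y, z].Nodup) (hy : Joined G s t (insert y (insert x S)))
    (hz : Joined G s t (insert z (insert x S))) : ShortWins G s t .short S C := by
  have hfree_x := hfree x (by simp)
  have hfree_y : Free s t (insert x S) C y := free_insert_left.mpr (by grind)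
  have hfree_z : Free s t (insert x S) (insert y C) z := by
    rw [free_insert_right, free_insert_left]
    grind
  exact .move S C x hfree_x
    (shortWins_cut_of_threat hfree_y hy (shortWins_of_joined_insert hfree_z hz))

lemma shortWins_of_forced_fork {x u y z z' : V}
    (hfree : ∀ v ∈ [x, u, y, z, z'], Free s t S C v) (hnodup : [x, u, y, z, z'].Nodup)
    (hu : Joined G s t (insert u (insert x S)))
    (hz : Joined G s t (insert z (insert y (insert x S))))
    (hz' : Joined G s t (insert z' (insert y (insert x S)))) : ShortWins G s t .short S C := by
  have hfree_x := hfree x (by simp)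
  have hfree_u : Free s t (insert x S) C u := free_insert_left.mpr (by grind)
  refine .move S C x hfree_x (shortWins_cut_of_threat hfree_u hu
    (shortWins_of_fork (fun v hv => ?_) (by grind) hz hz'))
  rw [free_insert_right, free_insert_left]
  grind

lemma shortWins_of_double_fork {x y y' z z' : V}
    (hfree : ∀ v ∈ [x, y, y', z, z'], Free s t S C v) (hnodup : [x, y, y', z, z'].Nodup)
    (hJ : ∀ u ∈ [y, y'], ∀ w ∈ [z, z'], Joined G s t (insert w (insert u (insert x S)))) :
    ShortWins G s t .short S C := by
  have hfree_of_ne : ∀ u, ∀ v ∈ [y, y', z, z'], v ≠ u →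
      Free s t (insert x S) (insert u C) v := fun u v hv hvu => by
    rw [free_insert_right, free_insert_left]
    grind
  have hfork_left : ∀ u ∈ [y, y'], ∀ v, v ∉ [u, z, z'] →
      ShortWins G s t .short (insert x S) (insert v C) := fun u hu v hv =>
    shortWins_of_fork (x := u) (y := z) (z := z') (fun w hw => hfree_of_ne v w (by grind)
      (by grind)) (by grind) (hJ u hu z (by simp)) (hJ u hu z' (by simp))
  have hfork_right : ∀ w ∈ [z, z'], ∀ v, v ∉ [w, y, y'] →
      ShortWins G s t .short (insert x S) (insert v C) := fun w hw v hv => by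
    refine shortWins_of_fork (x := w) (y := y) (z := y') (fun u hu => hfree_of_ne v u (by grind)
      (by grind)) (by grind) ?_ ?_ <;> rw [Set.insert_comm]
    exacts [hJ y (by simp) w hw, hJ y' (by simp) w hw]
  refine .move S C x (hfree x (by simp)) (.reply _ _ ⟨y, free_insert_left.mpr (by grind)⟩
    fun v _ => ?_)
  by_cases hv : v ∈ [z, z']
  · by_cases hvz : v = z
    · exact hfork_right z' (by simp) v (by grind)
    · exact hfork_right z (by simp) v (by grind)
  · by_cases hvy : v = y
    · exact hfork_left y' (by simp) v (by grind)
    · exact hfork_left y (by simp) v (by grind)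

end Threats

section Pairing

/-- Invariant of Cut's pairing strategy along the matching `M`: Cut has taken the `M`-partner of
every vertex of `S`. -/
def IsGuarded (M : SimpleGraph V) (S C : Set V) : Prop :=
  ∀ u ∈ S, M.neighborSet u ⊆ C

lemma IsGuarded.mono {S' : Set V} (hS : S' ⊆ S) (h : IsGuarded M S C) : IsGuarded M S' C :=
  fun u hu => h u (hS hu)

lemma IsGuarded.not_adj {x u v : V} (h : IsGuarded M (S \ {x}) C) (hSC : Disjoint S C)
    (hu : u ∈ S) (hv : v ∈ S) : ¬ M.Adj u v := by
  intro huv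
  rw [Set.disjoint_left] at hSC
  by_cases hux : u = x
  · exact hSC hu (h v ⟨hv, fun hvx => huv.ne (hux.trans hvx.symm)⟩ huv.symm)
  · exact hSC hv (h u ⟨hu, hux⟩ huv)

lemma IsGuarded.exists_reply {x : V} (h : IsGuarded M (S \ {x}) C) (hSC : Disjoint S C)
    (hM : Relator.RightUnique M.Adj) (hsupp : ∀ v ∈ M.support, Free s t ∅ ∅ v)
    (hne : ∃ v, Free s t S C v) : ∃ y, Free s t S C y ∧ IsGuarded M S (insert y C) := by
  by_cases hx : ∃ y, M.Adj x y ∧ Free s t S C y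
  · obtain ⟨y, hxy, hy⟩ := hx
    refine ⟨y, hy, fun u hu v huv => ?_⟩
    obtain rfl | hux := eq_or_ne u x
    · exact Or.inl (hM huv hxy)
    · exact Or.inr (h u ⟨hu, hux⟩ huv)
  · obtain ⟨y, hy⟩ := hne
    refine ⟨y, hy, fun u hu v huv => Or.inr ?_⟩
    obtain rfl | hux := eq_or_ne u x
    · have hv := free_empty.mp (hsupp v ⟨u, huv.symm⟩)
      have hvS : v ∉ S := fun hvS => h.not_adj hSC hu hvS huv
      by_contra hvC
      exact hx ⟨v, huv, hv.1, hv.2, hvS, hvC⟩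
    · exact h u ⟨hu, hux⟩ huv

/-- In Cut's turn the last vertex `x` taken by Short may still be unguarded. -/
lemma ShortWins.not_isGuarded {m : Player} (hM : Relator.RightUnique M.Adj)
    (hsupp : ∀ v ∈ M.support, Free s t ∅ ∅ v)
    (hJ : ∀ S, Joined G s t S → ∃ u ∈ S, ∃ v ∈ S, M.Adj u v) (h : ShortWins G s t m S C)
    (hSC : Disjoint S C) (x : V) (hcut : IsGuarded M (S \ {x}) C) :
    m = .short ∧ ¬ IsGuarded M S C := by
  rw [← Classical.not_imp]
  intro hshort
  induction h generalizing x with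
  | finished m S C _ hwin =>
    obtain ⟨u, hu, v, hv, huv⟩ := hJ S hwin
    exact hcut.not_adj hSC hu hv huv
  | move S C v hv _ ih =>
    refine ih (Set.disjoint_insert_left.mpr ⟨hv.2.2.2, hSC⟩) v ?_ nofun
    exact (hshort rfl).mono (by simp)
  | reply S C hne _ ih =>
    obtain ⟨y, hy, hguard⟩ := hcut.exists_reply hSC hM hsupp hne
    exact ih y hy (Set.disjoint_insert_right.mpr ⟨hy.2.2.1, hSC⟩) x
      (hguard.mono Set.sdiff_subset) fun _ => hguard

lemma not_shortWins_of_pairing (hM : Relator.RightUnique M.Adj)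
    (hsupp : ∀ v ∈ M.support, Free s t ∅ ∅ v)
    (hJ : ∀ S, Joined G s t S → ∃ u ∈ S, ∃ v ∈ S, M.Adj u v) :
    ¬ ShortWins G s t .short ∅ ∅ := by
  have hguard : IsGuarded M ∅ ∅ := fun _ hu => hu.elim
  exact fun h => (h.not_isGuarded hM hsupp hJ (by simp) s (hguard.mono (by simp))).2 hguard

lemma rightUnique_sup_edge {u v : V} (hM : Relator.RightUnique M.Adj) (hu : u ∉ M.support)
    (hv : v ∉ M.support) : Relator.RightUnique (M ⊔ SimpleGraph.edge u v).Adj := by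
  intro a b c hab hac
  simp only [SimpleGraph.mem_support, not_exists] at hu hv
  simp only [SimpleGraph.sup_adj, SimpleGraph.edge_adj] at hab hac
  have := @hM a b c
  grind

end Pairing

section Bridges

/-- The graph of the bridges: the edges of `G` joining a neighbour of `s` to a neighbour of `t`. A
set that contains both ends of a bridge joins the terminals. -/
def bridgeGraph (G : SimpleGraph V) (s t : V) : SimpleGraph V where
  Adj u v := G.Adj u v ∧ (G.Adj s u ∧ G.Adj t v ∨ G.Adj t u ∧ G.Adj s v)
  symm := ⟨fun _ _ h => ⟨h.1.symm, h.2.symm.imp And.symm And.symm⟩⟩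
  loopless := ⟨fun _ h => h.1.ne rfl⟩

lemma bridgeGraph_comm : bridgeGraph G t s = bridgeGraph G s t := by
  ext u v
  exact and_congr_right fun _ => or_comm

lemma centre_comm : centre G t s = centre G s t := by
  ext v
  simp only [centre, Set.mem_ofPred_eq]
  tauto

lemma weight_comm : weight t s = weight s t := by
  simp only [weight, and_comm]

lemma joined_of_bridge {u v : V} (huv : (bridgeGraph G s t).Adj u v) (hu : u ∈ S) (hv : v ∈ S) :
    Joined G s t S := by
  obtain ⟨hadj, ⟨hsu, htv⟩ | ⟨htu, hsv⟩⟩ := huv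
  · exact joined_of_path_two hsu hadj htv hu hv
  · exact joined_of_path_two hsv hadj.symm htu hv hu

lemma adj_or_adj_of_mem_support_bridgeGraph {v : V} (hv : v ∈ (bridgeGraph G s t).support) :
    G.Adj s v ∨ G.Adj t v := by
  obtain ⟨u, -, h | h⟩ := hv
  exacts [.inl h.1, .inr h.1]

lemma notMem_support_bridgeGraph {c : V} (hc : c ∈ centre G s t) :
    c ∉ (bridgeGraph G s t).support :=
  fun h => (adj_or_adj_of_mem_support_bridgeGraph h).elim hc.2.2.1 hc.2.2.2

lemma adj_right_of_bridge {u v : V} (hdisj : Disjoint (G.neighborSet s) (G.neighborSet t))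
    (huv : (bridgeGraph G s t).Adj u v) (hsu : G.Adj s u) : G.Adj t v :=
  (huv.2.resolve_right fun h => Set.disjoint_left.mp hdisj hsu h.1).2

lemma free_of_adj_or_adj {v : V} (hst : ¬ G.Adj s t) (hv : G.Adj s v ∨ G.Adj t v) :
    Free s t ∅ ∅ v := by
  rw [free_empty]
  constructor <;> rintro rfl
  exacts [hv.elim (fun h => h.ne rfl) fun h => hst h.symm, hv.elim hst fun h => h.ne rfl]

lemma forall_free_cons_append {c : V} {l₁ l₂ : List V} (hst : ¬ G.Adj s t)
    (hc : c ∈ centre G s t) (h₁ : ∀ v ∈ l₁, G.Adj s v) (h₂ : ∀ v ∈ l₂, G.Adj t v) :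
    ∀ v ∈ c :: (l₁ ++ l₂), Free s t ∅ ∅ v := by
  simp only [List.forall_mem_cons, List.forall_mem_append]
  exact ⟨free_empty.mpr ⟨hc.1, hc.2.1⟩, fun v hv => free_of_adj_or_adj hst (.inl (h₁ v hv)),
    fun v hv => free_of_adj_or_adj hst (.inr (h₂ v hv))⟩

lemma nodup_cons_append {c : V} {l₁ l₂ : List V}
    (hdisj : Disjoint (G.neighborSet s) (G.neighborSet t)) (hc : c ∈ centre G s t)
    (h₁ : ∀ v ∈ l₁, G.Adj s v) (h₂ : ∀ v ∈ l₂, G.Adj t v) (hl₁ : l₁.Nodup) (hl₂ : l₂.Nodup) :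
    (c :: (l₁ ++ l₂)).Nodup := by
  rw [List.nodup_cons, List.mem_append]
  exact ⟨fun hmem => hmem.elim (fun h => hc.2.2.1 (h₁ c h)) fun h => hc.2.2.2 (h₂ c h),
    hl₁.append hl₂ fun v hv hv' => Set.disjoint_left.mp hdisj (h₁ v hv) (h₂ v hv')⟩

lemma free_of_mem_support_bridgeGraph_sup_edge {c x v : V} (hst : ¬ G.Adj s t)
    (hc : c ∈ centre G s t) (hx : G.Adj s x ∨ G.Adj t x)
    (hv : v ∈ (bridgeGraph G s t ⊔ SimpleGraph.edge c x).support) : Free s t ∅ ∅ v := by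
  have hc_free : Free s t ∅ ∅ c := free_empty.mpr ⟨hc.1, hc.2.1⟩
  obtain ⟨u, h | h⟩ := hv
  · exact free_of_adj_or_adj hst (adj_or_adj_of_mem_support_bridgeGraph ⟨u, h⟩)
  · rw [SimpleGraph.edge_adj] at h
    obtain ⟨⟨rfl, -⟩ | ⟨rfl, -⟩, -⟩ := h
    exacts [hc_free, free_of_adj_or_adj hst hx]

lemma Joined.exists_bridge_or_exists_centre (hst : ¬ Joined G s t ∅)
    (hdisj : Disjoint (G.neighborSet s) (G.neighborSet t)) (h : Joined G s t S) :
    (∃ u ∈ S, ∃ v ∈ S, (bridgeGraph G s t).Adj u v) ∨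
      ∃ c ∈ centre G s t, c ∈ S ∧ ∃ a ∈ S, a ∈ G.commonNeighbors s c := by
  obtain ⟨W, hW⟩ := h
  -- A vertex of the walk followed by the first vertex outside `N(s)` other than `s`.
  obtain ⟨d, hd, hfst, hsnd⟩ := W.exists_boundary_dart (insert s (G.neighborSet s)) (by simp)
    (by simp [(ne_of_not_joined hst).symm, not_adj_of_not_joined hst])
  rw [Set.mem_insert_iff, SimpleGraph.mem_neighborSet, not_or] at hsnd
  have hsa : G.Adj s d.fst := hfst.resolve_left fun hds => hsnd.2 (hds ▸ d.adj)
  have hat : ¬ G.Adj t d.fst := Set.disjoint_left.mp hdisj hsa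
  have hc_ne : d.snd ≠ t := fun hdt => hat (hdt ▸ d.adj.symm)
  have ha_mem : d.fst ∈ S := by
    have hfree := free_empty.mp (free_of_adj_or_adj (not_adj_of_not_joined hst) (.inl hsa))
    exact ((hW _ (W.dart_fst_mem_support_of_mem_darts hd)).resolve_left hfree.1).resolve_left
      hfree.2
  have hc_mem : d.snd ∈ S :=
    ((hW _ (W.dart_snd_mem_support_of_mem_darts hd)).resolve_left hsnd.1).resolve_left hc_ne
  by_cases htc : G.Adj t d.snd
  · exact .inl ⟨d.fst, ha_mem, d.snd, hc_mem, d.adj, .inl ⟨hsa, htc⟩⟩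
  · exact .inr ⟨d.snd, ⟨hsnd.1, hc_ne, hsnd.2, htc⟩, hc_mem, d.fst, ha_mem, hsa, d.adj.symm⟩

/-- If Cut cannot win by pairing along `M`, then some path through `c` has no two inner vertices
paired by `M`. -/
lemma ShortWins.exists_unpaired_path {c : V} (h : ShortWins G s t .short ∅ ∅)
    (hst : ¬ Joined G s t ∅) (hdisj : Disjoint (G.neighborSet s) (G.neighborSet t))
    (hcen : centre G s t ⊆ {c}) (hM : Relator.RightUnique M.Adj)
    (hsupp : ∀ v ∈ M.support, Free s t ∅ ∅ v) (hle : bridgeGraph G s t ≤ M) :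
    c ∈ centre G s t ∧ ∃ a ∈ G.commonNeighbors s c, ∃ b ∈ G.commonNeighbors t c,
      ¬ M.Adj a b ∧ ¬ M.Adj a c ∧ ¬ M.Adj b c := by
  by_contra! hcon
  refine not_shortWins_of_pairing hM hsupp (fun S hJ => ?_) h
  obtain ⟨u, hu, v, hv, huv⟩ | ⟨c', hc', hcS, a, haS, ha⟩ :=
    hJ.exists_bridge_or_exists_centre hst hdisj
  · exact ⟨u, hu, v, hv, hle huv⟩
  obtain ⟨u, hu, v, hv, huv⟩ | ⟨c'', hc'', -, b, hbS, hb⟩ :=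
    hJ.symm.exists_bridge_or_exists_centre (fun hJ' => hst hJ'.symm) hdisj.symm
  · exact ⟨u, hu, v, hv, hle (bridgeGraph_comm (G := G) ▸ huv)⟩
  obtain rfl : c' = c := hcen hc'
  obtain rfl : c'' = c' := hcen (centre_comm (G := G) ▸ hc'')
  by_cases hab : M.Adj a b
  · exact ⟨a, haS, b, hbS, hab⟩
  by_cases hac : M.Adj a c''
  · exact ⟨a, haS, c'', hcS, hac⟩
  · exact ⟨b, hbS, c'', hcS, hcon hc' a ha b hb hab hac⟩

end Bridges

section Critical

/-- Criticality for Short, the form in which minimality of a weak link is used: the terminals are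
not joined before the first move, and Short wins as first player on `G` but on no proper subgraph.
Minimality refers to all subgraphs, not only to deletions of a single edge. -/
structure IsShortCritical (G : SimpleGraph V) (s t : V) : Prop where
  not_joined : ¬ Joined G s t ∅
  minimal : Minimal (fun H => ShortWins H s t .short ∅ ∅) G

lemma IsMinimalWeakLink.isShortCritical (h : IsMinimalWeakLink G s t) :
    IsShortCritical G s t where
  not_joined := h.1.2.not_joined
  minimal := by
    refine minimal_iff_forall_lt.mpr ⟨h.1.1, fun H hlt hH => ?_⟩
    obtain ⟨e, heG, heH⟩ := Set.exists_of_ssubset (SimpleGraph.edgeSet_ssubset_edgeSet.mpr hlt)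
    have hle : H ≤ G.deleteEdges {e} := fun u v huv => by
      rw [SimpleGraph.deleteEdges_adj]
      exact ⟨hlt.le huv, fun he => heH (Set.mem_singleton_iff.mp he ▸ huv)⟩
    exact (h.2 e heG).1 ⟨hH.mono_graph hle, h.1.2.anti_graph (G.deleteEdges_le _)⟩

lemma IsShortCritical.symm (h : IsShortCritical G s t) : IsShortCritical G t s where
  not_joined hJ := h.not_joined hJ.symm
  minimal := ⟨h.minimal.prop.symm, fun _ hH => h.minimal.le_of_le hH.symm⟩

lemma IsShortCritical.not_adj (h : IsShortCritical G s t) : ¬ G.Adj s t :=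
  not_adj_of_not_joined h.not_joined

lemma IsShortCritical.support_subset {X : Set V} (h : IsShortCritical G s t)
    (hX : ShortWins (G.induce X).spanningCoe s t .short ∅ ∅) : G.support ⊆ X :=
  (G.spanningCoe_induce_eq_self X).mp (h.minimal.eq_of_le hX (G.spanningCoe_induce_le X))

lemma ncard_setOf_mem_list_le (l : List V) : {v | v ∈ l}.ncard ≤ l.length := by
  classical
  rw [← List.coe_toFinset, Set.ncard_coe_finset]
  exact l.toFinset_card_le

lemma weight_le_length {l : List V} (hsupp : G.support ⊆ {v | v ∈ s :: t :: l})
    (hcen : centre G s t ⊆ {v | v ∈ l}) : weight s t ≤ l.length := by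
  refine (Set.ncard_le_ncard (fun v hv => ?_) l.finite_toSet).trans (ncard_setOf_mem_list_le l)
  by_cases hadj : G.Adj s v ∨ G.Adj t v
  · have hv_mem : v ∈ s :: t :: l := hsupp (hadj.elim (fun h => ⟨s, h.symm⟩) fun h => ⟨t, h.symm⟩)
    simpa [hv.1, hv.2] using hv_mem
  · rw [not_or] at hadj
    exact hcen ⟨hv.1, hv.2, hadj⟩

lemma IsShortCritical.exists_unbridged_path {c : V} (h : IsShortCritical G s t)
    (hdisj : Disjoint (G.neighborSet s) (G.neighborSet t))
    (hM : Relator.RightUnique (bridgeGraph G s t).Adj) (hcen : centre G s t = {c}) :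
    ∃ a ∈ G.commonNeighbors s c, ∃ b ∈ G.commonNeighbors t c, ¬ (bridgeGraph G s t).Adj a b := by
  obtain ⟨-, a, ha, b, hb, hab, -⟩ := h.minimal.prop.exists_unpaired_path h.not_joined hdisj
    hcen.subset hM
    (fun v hv => free_of_adj_or_adj h.not_adj (adj_or_adj_of_mem_support_bridgeGraph hv)) le_rfl
  exact ⟨a, ha, b, hb, hab⟩

lemma IsShortCritical.exists_unbridged_path_avoiding {c x : V} (h : IsShortCritical G s t)
    (hdisj : Disjoint (G.neighborSet s) (G.neighborSet t))
    (hM : Relator.RightUnique (bridgeGraph G s t).Adj) (hcen : centre G s t = {c})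
    (hx : G.Adj s x ∨ G.Adj t x) (hx_supp : x ∉ (bridgeGraph G s t).support) :
    ∃ a ∈ G.commonNeighbors s c, ∃ b ∈ G.commonNeighbors t c,
      a ≠ x ∧ b ≠ x ∧ ¬ (bridgeGraph G s t).Adj a b := by
  have hc : c ∈ centre G s t := hcen.superset rfl
  have hcx : c ≠ x := by
    rintro rfl
    exact hx.elim hc.2.2.1 hc.2.2.2
  obtain ⟨-, a, ha, b, hb, hab, hac, hbc⟩ := h.minimal.prop.exists_unpaired_path h.not_joined
    hdisj hcen.subset (rightUnique_sup_edge hM (notMem_support_bridgeGraph hc) hx_supp)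
    (fun v => free_of_mem_support_bridgeGraph_sup_edge h.not_adj hc hx) le_sup_left
  have hxc : (bridgeGraph G s t ⊔ SimpleGraph.edge c x).Adj x c :=
    .inr (SimpleGraph.edge_adj .. |>.mpr ⟨.inr ⟨rfl, rfl⟩, hcx.symm⟩)
  exact ⟨a, ha, b, hb, fun hax => hac (hax ▸ hxc), fun hbx => hbc (hbx ▸ hxc),
    fun hadj => hab (.inl hadj)⟩

variable [Finite V]

lemma weight_le_length_add {l : List V} (hsupp : G.support ⊆ {v | v ∈ s :: t :: l}) :
    weight s t ≤ l.length + (centre G s t).ncard := by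
  obtain ⟨k, hk⟩ := (centre G s t).toFinite.exists_finset_coe
  have h := weight_le_length (G := G) (s := s) (t := t) (l := l ++ k.toList)
    (fun v hv => by have := hsupp hv; grind)
    (fun v hv => by simp [← Finset.mem_coe, hk, hv])
  rwa [List.length_append, Finset.length_toList, ← Set.ncard_coe_finset, hk] at h

lemma IsShortCritical.support_subset_of_common_neighbor (h : IsShortCritical G s t) {a : V}
    (hsa : G.Adj s a) (hta : G.Adj t a) : G.support ⊆ {v | v ∈ [s, t, a]} :=
  h.support_subset (shortWins_of_joined_insert (free_of_adj_or_adj h.not_adj (.inl hsa))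
    ((joined_of_common_neighbor hsa hta (Set.mem_insert a ∅)).induce
      (by simp [Set.insert_subset_iff])))

lemma IsShortCritical.disjoint_neighborSet (h : IsShortCritical G s t)
    (hw : 1 + (centre G s t).ncard < weight s t) :
    Disjoint (G.neighborSet s) (G.neighborSet t) :=
  Set.disjoint_left.mpr fun _ hsa hta =>
    hw.not_ge (weight_le_length_add (h.support_subset_of_common_neighbor hsa hta))

lemma IsShortCritical.rightUnique_bridgeGraph (h : IsShortCritical G s t)
    (hw : 3 + (centre G s t).ncard < weight s t) :
    Relator.RightUnique (bridgeGraph G s t).Adj := by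
  intro a b b' hab hab'
  by_contra hbb
  have hfree : ∀ v ∈ [a, b, b'], Free s t ∅ ∅ v := fun v hv => by
    refine free_of_adj_or_adj h.not_adj (adj_or_adj_of_mem_support_bridgeGraph ?_)
    simp only [List.mem_cons, List.not_mem_nil, or_false] at hv
    rcases hv with rfl | rfl | rfl
    exacts [⟨b, hab⟩, ⟨a, hab.symm⟩, ⟨a, hab'.symm⟩]
  have hnodup : [a, b, b'].Nodup := by simp [hab.ne, hab'.ne, hbb]
  exact hw.not_ge (weight_le_length_add (l := [a, b, b']) (h.support_subset
    (shortWins_of_fork hfree hnodup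
      ((joined_of_bridge hab (by simp) (by simp)).induce (by simp [Set.insert_subset_iff]))
      ((joined_of_bridge hab' (by simp) (by simp)).induce (by simp [Set.insert_subset_iff])))))

lemma IsShortCritical.weight_le_three (h : IsShortCritical G s t)
    (hcen : (centre G s t).ncard = 0) : weight s t ≤ 3 := by
  by_contra! hw
  have hcen_empty : centre G s t = ∅ := (Set.ncard_eq_zero (Set.toFinite _)).mp hcen
  obtain ⟨hs, -⟩ := h.minimal.prop.exists_unpaired_path (c := s) h.not_joined
    (h.disjoint_neighborSet (by omega)) (hcen_empty ▸ Set.empty_subset _)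
    (h.rightUnique_bridgeGraph (by omega))
    (fun v hv => free_of_adj_or_adj h.not_adj (adj_or_adj_of_mem_support_bridgeGraph hv)) le_rfl
  exact hs.1 rfl

section SingletonCentre

variable {c : V}

lemma IsShortCritical.weight_le_five_of_forced_fork {x u y z z' : V} (h : IsShortCritical G s t)
    (hcen : centre G s t = {c}) (hc : c ∈ [x, u, y, z, z'])
    (hfree : ∀ v ∈ [x, u, y, z, z'], Free s t ∅ ∅ v) (hnodup : [x, u, y, z, z'].Nodup)
    (hu : Joined G s t {u, x}) (hz : Joined G s t {z, y, x}) (hz' : Joined G s t {z', y, x}) :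
    weight s t ≤ 5 := by
  rw [← insert_empty_eq x] at hu hz hz'
  have hwin : ShortWins (G.induce {v | v ∈ s :: t :: [x, u, y, z, z']}).spanningCoe s t
      .short ∅ ∅ := shortWins_of_forced_fork hfree hnodup
    (hu.induce (by simp [Set.insert_subset_iff])) (hz.induce (by simp [Set.insert_subset_iff]))
    (hz'.induce (by simp [Set.insert_subset_iff]))
  exact weight_le_length (h.support_subset hwin) (hcen ▸ Set.singleton_subset_iff.mpr hc)

lemma IsShortCritical.weight_le_five_of_nontrivial (h : IsShortCritical G s t)
    (hdisj : Disjoint (G.neighborSet s) (G.neighborSet t)) (hcen : centre G s t = {c})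
    (hs : (G.commonNeighbors s c).Nontrivial) (ht : (G.commonNeighbors t c).Nontrivial) :
    weight s t ≤ 5 := by
  have hc : c ∈ centre G s t := hcen.superset rfl
  obtain ⟨a, ha, a', ha', haa⟩ := hs
  obtain ⟨b, hb, b', hb', hbb⟩ := ht
  have hsa : ∀ v ∈ [a, a'], G.Adj s v := by simpa using ⟨ha.1, ha'.1⟩
  have htb : ∀ v ∈ [b, b'], G.Adj t v := by simpa using ⟨hb.1, hb'.1⟩
  have hfree := forall_free_cons_append h.not_adj hc hsa htb
  have hnodup := nodup_cons_append hdisj hc hsa htb (by simpa using haa) (by simpa using hbb)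
  have hwin : ShortWins (G.induce {v | v ∈ s :: t :: [c, a, a', b, b']}).spanningCoe s t
      .short ∅ ∅ := by
    refine shortWins_of_double_fork hfree hnodup fun u hu w hw => ?_
    have hu_mem : u ∈ G.commonNeighbors s c := by
      obtain rfl | rfl := List.mem_pair.mp hu <;> assumption
    have hw_mem : w ∈ G.commonNeighbors t c := by
      obtain rfl | rfl := List.mem_pair.mp hw <;> assumption
    exact (joined_of_path_three hu_mem hw_mem (by simp) (by simp) (by simp)).induce
      (by simp only [Set.insert_subset_iff]; grind)
  exact weight_le_length (h.support_subset hwin) (by simp [hcen])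

lemma IsShortCritical.weight_le_five_of_two_bridges {a a' b b' : V} (h : IsShortCritical G s t)
    (hdisj : Disjoint (G.neighborSet s) (G.neighborSet t)) (hcen : centre G s t = {c})
    (ha : a ∈ G.commonNeighbors s c) (hb' : b' ∈ G.commonNeighbors t c)
    (hab : (bridgeGraph G s t).Adj a b) (hab' : (bridgeGraph G s t).Adj a' b')
    (haa' : a ≠ a') (hbb' : b ≠ b') : weight s t ≤ 5 := by
  have hc : c ∈ centre G s t := hcen.superset rfl
  have hsa' : G.Adj s a' :=
    adj_right_of_bridge hdisj.symm (bridgeGraph_comm (G := G) ▸ hab'.symm) hb'.1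
  have hs : ∀ v ∈ [a, a'], G.Adj s v := by simpa using ⟨ha.1, hsa'⟩
  have ht : ∀ v ∈ [b, b'], G.Adj t v := by
    simpa using ⟨adj_right_of_bridge hdisj hab ha.1, hb'.1⟩
  have hfree := forall_free_cons_append h.not_adj hc hs ht
  have hnodup := nodup_cons_append hdisj hc hs ht (by simpa using haa') (by simpa using hbb')
  exact h.weight_le_five_of_forced_fork (x := a) (u := b) (y := b') (z := c) (z' := a') hcen
    (by simp) (by grind) (by grind) (joined_of_bridge hab (by simp) (by simp))
    (joined_of_path_three ha hb' (by simp) (by simp) (by simp))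
    (joined_of_bridge hab' (by simp) (by simp))

lemma IsShortCritical.weight_le_five_of_bridge_of_two_common_neighbors {a b b' b'' : V}
    (h : IsShortCritical G s t) (hdisj : Disjoint (G.neighborSet s) (G.neighborSet t))
    (hcen : centre G s t = {c}) (ha : a ∈ G.commonNeighbors s c)
    (hb' : b' ∈ G.commonNeighbors t c) (hb'' : b'' ∈ G.commonNeighbors t c)
    (hab : (bridgeGraph G s t).Adj a b) (hnodup : [b, b', b''].Nodup) : weight s t ≤ 5 := by
  have hc : c ∈ centre G s t := hcen.superset rfl
  have hs : ∀ v ∈ [a], G.Adj s v := by simpa using ha.1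
  have ht : ∀ v ∈ [b, b', b''], G.Adj t v := by
    simpa using ⟨adj_right_of_bridge hdisj hab ha.1, hb'.1, hb''.1⟩
  have hfree := forall_free_cons_append h.not_adj hc hs ht
  have hnodup_all := nodup_cons_append hdisj hc hs ht (by simp) hnodup
  exact h.weight_le_five_of_forced_fork (x := a) (u := b) (y := c) (z := b') (z' := b'') hcen
    (by simp) (by grind) (by grind) (joined_of_bridge hab (by simp) (by simp))
    (joined_of_path_three ha hb' (by simp) (by simp) (by simp))
    (joined_of_path_three ha hb'' (by simp) (by simp) (by simp))

lemma IsShortCritical.weight_le_five_of_subsingleton (h : IsShortCritical G s t)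
    (hdisj : Disjoint (G.neighborSet s) (G.neighborSet t))
    (hM : Relator.RightUnique (bridgeGraph G s t).Adj) (hcen : centre G s t = {c})
    (hs : (G.commonNeighbors s c).Subsingleton) : weight s t ≤ 5 := by
  obtain ⟨a, ha, b', hb', hab'⟩ := h.exists_unbridged_path hdisj hM hcen
  obtain ⟨b, hab⟩ : a ∈ (bridgeGraph G s t).support := by
    by_contra ha_supp
    obtain ⟨a', ha', -, -, ha'_ne, -⟩ :=
      h.exists_unbridged_path_avoiding hdisj hM hcen (.inl ha.1) ha_supp
    exact ha'_ne (hs ha' ha)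
  have hbb' : b ≠ b' := fun e => hab' (e ▸ hab)
  by_cases hb'_supp : b' ∈ (bridgeGraph G s t).support
  · obtain ⟨a', hb'a'⟩ := hb'_supp
    exact h.weight_le_five_of_two_bridges hdisj hcen ha hb' hab hb'a'.symm
      (fun e => hab' (e ▸ hb'a'.symm)) hbb'
  · obtain ⟨a', ha', b'', hb'', -, hb''_ne, hab''⟩ :=
      h.exists_unbridged_path_avoiding hdisj hM hcen (.inr hb'.1) hb'_supp
    obtain rfl : a' = a := hs ha' ha
    have hbb'' : b ≠ b'' := fun e => hab'' (e ▸ hab)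
    exact h.weight_le_five_of_bridge_of_two_common_neighbors hdisj hcen ha' hb' hb'' hab
      (by simp [hbb', hbb'', hb''_ne.symm])

end SingletonCentre

lemma IsShortCritical.weight_le_five (h : IsShortCritical G s t)
    (hcen : (centre G s t).ncard = 1) : weight s t ≤ 5 := by
  by_contra! hw
  obtain ⟨c, hc⟩ := Set.ncard_eq_one.mp hcen
  have hdisj := h.disjoint_neighborSet (by omega)
  have hM := h.rightUnique_bridgeGraph (by omega)
  refine hw.not_ge ?_
  by_cases hs : (G.commonNeighbors s c).Subsingleton
  · exact h.weight_le_five_of_subsingleton hdisj hM hc hs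
  by_cases ht : (G.commonNeighbors t c).Subsingleton
  · rw [weight_comm]
    exact h.symm.weight_le_five_of_subsingleton hdisj.symm (bridgeGraph_comm (G := G) ▸ hM)
      (centre_comm.trans hc) ht
  · rw [Set.not_subsingleton_iff] at hs ht
    exact h.weight_le_five_of_nontrivial hdisj hc hs ht

end Critical

section Degrees

variable [Fintype V] [DecidableRel G.Adj]

lemma degree_add_degree_add_ncard_centre (hst : ¬ G.Adj s t)
    (hdisj : Disjoint (G.neighborSet s) (G.neighborSet t)) :
    G.degree s + G.degree t + (centre G s t).ncard = weight s t := by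
  have hdisj_centre : Disjoint (G.neighborSet s ∪ G.neighborSet t) (centre G s t) :=
    Set.disjoint_left.mpr fun v hv hc => hv.elim hc.2.2.1 hc.2.2.2
  have hdegree : ∀ v, G.degree v = (G.neighborSet v).ncard := fun v => by
    rw [← G.card_neighborFinset_eq_degree, ← Set.ncard_coe_finset, G.coe_neighborFinset]
  rw [hdegree, hdegree, ← Set.ncard_union_eq hdisj, ← Set.ncard_union_eq hdisj_centre, weight]
  congr 1
  ext v
  constructor
  · rintro (hv | hv)
    exacts [free_empty.mp (free_of_adj_or_adj hst hv), ⟨hv.1, hv.2.1⟩]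
  · intro hv
    by_cases hadj : G.Adj s v ∨ G.Adj t v
    exacts [.inl hadj, .inr ⟨hv.1, hv.2, not_or.mp hadj⟩]

lemma degree_le_one_of_support_subset {a : V} (hst : ¬ G.Adj s t)
    (hsupp : G.support ⊆ {v | v ∈ [s, t, a]}) : G.degree s ≤ 1 := by
  rw [← G.card_neighborFinset_eq_degree, ← Finset.card_singleton a]
  refine Finset.card_le_card fun u hu => ?_
  rw [SimpleGraph.mem_neighborFinset] at hu
  have hu_mem : u ∈ [s, t, a] := hsupp ⟨s, hu.symm⟩
  simp only [List.mem_cons, List.not_mem_nil, or_false] at hu_mem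
  obtain rfl | rfl | rfl := hu_mem
  exacts [(hu.ne rfl).elim, (hst hu).elim, Finset.mem_singleton_self u]

lemma IsShortCritical.degree_add_degree_mul_two_le (h : IsShortCritical G s t)
    (hw : weight s t ≤ 7) : (G.degree s + G.degree t) * 2 ≤ weight s t + 3 := by
  by_cases hdisj : Disjoint (G.neighborSet s) (G.neighborSet t)
  · have hweight := degree_add_degree_add_ncard_centre h.not_adj hdisj
    have hzero := h.weight_le_three
    have hone := h.weight_le_five
    omega
  · obtain ⟨a, hsa, hta⟩ := Set.not_disjoint_iff.mp hdisj
    have hs : G.degree s ≤ 1 := degree_le_one_of_support_subset h.not_adj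
      (h.support_subset_of_common_neighbor hsa hta)
    have ht : G.degree t ≤ 1 := degree_le_one_of_support_subset h.symm.not_adj
      (h.symm.support_subset_of_common_neighbor hta hsa)
    have hpos : 0 < weight s t := (Set.ncard_pos (Set.toFinite _)).mpr
      ⟨a, free_empty.mp (free_of_adj_or_adj h.not_adj (.inl hsa))⟩
    omega

end Degrees

end ShannonGame

theorem mainTheorem2 {V : Type*} [Fintype V] (G : SimpleGraph V) [DecidableRel G.Adj]
    (s t : V) (hst : s ≠ t) (hmin : ShannonGame.IsMinimalWeakLink G s t) :
    (3 < ShannonGame.weight s t → 1 ≤ (ShannonGame.centre G s t).ncard) ∧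
    (5 < ShannonGame.weight s t → 2 ≤ (ShannonGame.centre G s t).ncard) ∧
    (ShannonGame.weight s t ≤ 7 →
      (G.degree s : ℚ) + (G.degree t : ℚ) ≤ ((ShannonGame.weight s t : ℚ) + 3) / 2) := by
  have h := hmin.isShortCritical
  have h_zero := h.weight_le_three
  have h_one := h.weight_le_five
  refine ⟨by omega, by omega, fun hw => ?_⟩
  rw [le_div_iff₀ two_pos]
  exact_mod_cast h.degree_add_degree_mul_two_le hw
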